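/- Let $W\in\mathbb C[x_1,\dots,x_N]$ be a nondegenerate quasi-homogeneous polynomial: there are positive integers $w_1,\dots,w_N,d$ with $W(t^{w_1}x_1,\dots,t^{w_N}x_N)=t^dW(x_1,\dots,x_N)$, and the origin is the only critical point of $W$ in $\mathbb C^N$. Identify $b=(b_1,\dots,b_N)\in\mathbb C^N$ with the linear perturbation $W_0=\sum_i b_ix_i$. Let $R\subset\mathbb C^N$ be the set of $W$-regular perturbations, i.e. those $b$ for which $W+W_0$ is holomorphic Morse (all its critical points are nondegenerate), and let $H\subset R$ be the set of those $b\in R$ for which two different critical points $\kappa\ne\kappa'$ of $W+W_0$ satisfy $\operatorname{Im}(W+W_0)(\kappa)=\operatorname{Im}(W+W_0)(\kappa')$. Then: 1. $R$ is a nonempty, path-connected, open subset of $\mathbb C^N$. 2. $H$ is a union of finitely many smooth (embedded, real codimension one) real hypersurfaces. More precisely, $R$ is a union of finitely many open sets $U_1,\dots,U_m$ such that each $H\cap U_k$ is a finite union of smooth real hypersurfaces that are closed in $U_k$. 3. $H$ divides $R$ into chambers: the connected components of $R\setminus H$ (the chambers) are open, path-connected and pairwise disjoint, their union is $R\setminus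 H$, the boundary points in $R$ of every chamber lie in $H$, and every point of $R$ lies in the closure of some chamber. -/

import Mathlib

open scoped ContDiff

namespace LandauGinzburg

/-- `W ∈ ℂ[x₁, …, x_N]` is quasi-homogeneous: there are positive integers `w₁, …, w_N` and `d`
with `W (t ^ w₁ x₁, …, t ^ w_N x_N) = t ^ d W (x₁, …, x_N)`; the weight of `xᵢ` is `wᵢ / d`. -/
def IsQuasiHomogeneous {N : ℕ} (W : MvPolynomial (Fin N) ℂ) : Prop :=
  ∃ (w : Fin N → ℕ) (d : ℕ), (∀ i, 0 < w i) ∧ 0 < d ∧ W.IsWeightedHomogeneous w d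

/-- `x` is a critical point of the polynomial function `P : ℂ^N → ℂ`. -/
def IsCriticalPoint {N : ℕ} (P : MvPolynomial (Fin N) ℂ) (x : Fin N → ℂ) : Prop :=
  ∀ i, MvPolynomial.eval x (MvPolynomial.pderiv i P) = 0

/-- A (quasi-homogeneous) polynomial is nondegenerate if the origin is its only critical point.
For quasi-homogeneous polynomials this says that the origin is an isolated singularity. -/
def IsNondegenerate {N : ℕ} (W : MvPolynomial (Fin N) ℂ) : Prop :=
  ∀ x : Fin N → ℂ, IsCriticalPoint W x ↔ x = 0

/-- The complex Hessian matrix of `P` at `x`. -/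
noncomputable def hessian {N : ℕ} (P : MvPolynomial (Fin N) ℂ) (x : Fin N → ℂ) :
    Matrix (Fin N) (Fin N) ℂ :=
  Matrix.of fun i j =>
    MvPolynomial.eval x (MvPolynomial.pderiv i (MvPolynomial.pderiv j P))

/-- `P` is holomorphic Morse: all its critical points are nondegenerate. -/
def IsHolomorphicMorse {N : ℕ} (P : MvPolynomial (Fin N) ℂ) : Prop :=
  ∀ x : Fin N → ℂ, IsCriticalPoint P x → (hessian P x).det ≠ 0

/-- The polynomial `W + W₀` with the linear perturbation `W₀ = ∑ i, b i * x i`. -/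
noncomputable def perturbed {N : ℕ} (W : MvPolynomial (Fin N) ℂ) (b : Fin N → ℂ) :
    MvPolynomial (Fin N) ℂ :=
  W + ∑ i, MvPolynomial.C (b i) * MvPolynomial.X i

/-- The set of (coefficient vectors of) `W`-regular linear perturbations. -/
def regularSet {N : ℕ} (W : MvPolynomial (Fin N) ℂ) : Set (Fin N → ℂ) :=
  {b | IsHolomorphicMorse (perturbed W b)}

/-- The set of `W`-regular perturbations for which two different critical points of `W + W₀`
have critical values with the same imaginary part. -/
def wall {N : ℕ} (W : MvPolynomial (Fin N) ℂ) : Set (Fin N → ℂ) :=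
  {b | b ∈ regularSet W ∧ ∃ x y : Fin N → ℂ, x ≠ y ∧
    IsCriticalPoint (perturbed W b) x ∧ IsCriticalPoint (perturbed W b) y ∧
    (MvPolynomial.eval x (perturbed W b)).im = (MvPolynomial.eval y (perturbed W b)).im}

/-- `S` is a smooth real hypersurface of the real normed space `E`, that is, an embedded smooth
submanifold of real codimension one (not necessarily closed in `E`): near each of its points
`S` is the zero set of a smooth real function whose differential vanishes nowhere on it. -/
def IsSmoothRealHypersurface {E : Type*} [NormedAddCommGroup E] [NormedSpace ℝ E]
    (S : Set E) : Prop :=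
  ∀ p ∈ S, ∃ V : Set E, IsOpen V ∧ p ∈ V ∧ ∃ f : E → ℝ, ContDiffOn ℝ ∞ f V ∧
    (∀ x ∈ V, f x = 0 → fderiv ℝ f x ≠ 0) ∧ S ∩ V = {x | x ∈ V ∧ f x = 0}

/-- The chambers: the connected components of the complement of the walls in the set of
`W`-regular perturbations. -/
def chambers {N : ℕ} (W : MvPolynomial (Fin N) ℂ) : Set (Set (Fin N → ℂ)) :=
  {C | ∃ b ∈ regularSet W \ wall W, C = connectedComponentIn (regularSet W \ wall W) b}

end LandauGinzburg

/-!
The critical points of `W + ∑ bᵢ xᵢ` are the points over `b` of the negative gradient map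
`G = -∇W : ℂ^N → ℂ^N`, and the perturbation `b` is regular exactly when the Jacobian determinant `J`
of `G` vanishes at none of them. All that is needed about `G` follows from one algebraic fact.

**Finiteness.** The components of `G` are quasi-homogeneous of positive degree and have only the
origin as a common zero. By the Nullstellensatz they generate an ideal that contains powers of all
the variables, and a graded Nakayama argument (`span_monomial_Iic_eq_top`) shows that `ℂ[x]` is
a finite module over the subalgebra `A` generated by the components of `G`. Hence:

* every coordinate satisfies a monic equation with coefficients in `A`, so `G` is proper with finite
  fibres (`isProperMap_polyMap`, `finite_fiber_polyMap`);
* `J ≠ 0`, since a derivation killing `A` kills everything integral over `A`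
  (`det_jacobian_ne_zero`);
* the constant coefficient of the minimal polynomial of `J` over `A` is `g(G)` for some nonzero
  polynomial `g`, and `g` vanishes at all critical values of `G`.

**The regular set.** It is open because `G` is proper, and path-connected because a complex line that
is not contained in `{g = 0}` meets it in a finite set. By the inverse function theorem and
properness, the points over `b` are given near each regular value by smooth functions `κᵢ(b)`.
The Besicovitch covering theorem covers the regular set by finitely many disjoint unions of small
balls, and on such a disjoint union the local functions `κᵢ` can be chosen independently on each
ball; so finitely many open sets with globally defined `κᵢ` suffice
(`exists_finite_cover_hasSmoothSections`).

**The walls.** On such an open set the wall is the union of the zero sets of the functions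
`Im (W_b(κᵢ(b)) - W_b(κⱼ(b)))`, `i ≠ j`. Since `κᵢ(b)` is a critical point of `W_b`, the derivative of
`W_b(κᵢ(b))` in the direction `v` is `∑ₗ κᵢ(b)ₗ vₗ`; as the `κᵢ(b)` are distinct, the differentials of
these functions vanish nowhere (`exists_wall_equations`), and the zero sets are smooth
hypersurfaces.

**The chambers.** The complement of the walls is open, so its components are open and
path-connected. A point of the regular set is in the closure of a component because a short segment
starting there in a generic direction leaves all the hypersurfaces through it
(`mem_closure_connectedComponentIn`).
-/

namespace LandauGinzburg

open MvPolynomial Topology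

/-! ### Finiteness over the subalgebra generated by the components -/

section Finiteness

variable {k σ : Type*}

attribute [local instance] MvPolynomial.weightedGradedAlgebra in
/-- A graded Nakayama lemma: if the ideal generated by quasi-homogeneous polynomials `G j` of
positive degrees contains the powers `X i ^ r i`, then the monomials with exponents at most `r`
span the polynomial ring over the subalgebra generated by the `G j`. A larger monomial is
a combination of the `G j` with coefficients of smaller weighted degree. -/
theorem span_monomial_Iic_eq_top [CommRing k] [Finite σ] {w e : σ → ℕ}
    {G : σ → MvPolynomial σ k} (he : ∀ j, 0 < e j)
    (hG : ∀ j, (G j).IsWeightedHomogeneous w (e j)) {r : σ →₀ ℕ}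
    (hr : ∀ i, (X i : MvPolynomial σ k) ^ r i ∈ Ideal.span (Set.range G)) :
    Submodule.span (Algebra.adjoin k (Set.range G))
      ((fun m => monomial m (1 : k)) '' Set.Iic r) = ⊤ := by
  classical
  have := Fintype.ofFinite σ
  set M := Submodule.span (Algebra.adjoin k (Set.range G))
      ((fun m => monomial m (1 : k)) '' Set.Iic r) with hM
  have key : ∀ n (φ : MvPolynomial σ k), φ.IsWeightedHomogeneous w n → φ ∈ M := by
    intro n
    induction n using Nat.strong_induction_on with
    | _ n ih =>
      intro φ hφ
      rw [φ.as_sum]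
      refine Submodule.sum_mem _ fun m hm => ?_
      have hmn : Finsupp.weight w m = n := hφ (mem_support_iff.1 hm)
      set c := coeff m φ
      by_cases hmr : m ≤ r
      · have : monomial m c = algebraMap k (Algebra.adjoin k (Set.range G)) c •
            monomial m (1 : k) := by
          rw [algebraMap_smul, smul_monomial, smul_eq_mul, mul_one]
        rw [this]
        exact Submodule.smul_mem _ _ (Submodule.subset_span ⟨m, hmr, rfl⟩)
      · obtain ⟨i, hi⟩ : ∃ i, r i < m i := by
          simpa [Finsupp.le_def] using hmr
        have hmem : monomial m c ∈ Ideal.span (Set.range G) := by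
          have : monomial m c = monomial (m - Finsupp.single i (r i)) c * X i ^ r i := by
            rw [X_pow_eq_monomial, monomial_mul, mul_one, tsub_add_cancel_of_le]
            simpa using hi.le
          rw [this]
          exact Ideal.mul_mem_left _ _ (hr i)
        obtain ⟨h, hh⟩ := Ideal.mem_span_range_iff_exists_fun.1 hmem
        -- only the part of `h j` of degree `n - e j` contributes
        have hcomp : monomial m c = ∑ j, if e j ≤ n then
            (DirectSum.decompose (weightedHomogeneousSubmodule k w) (h j) (n - e j) :
              MvPolynomial σ k) * G j else 0 := by
          have h1 : (DirectSum.decompose (weightedHomogeneousSubmodule k w) (monomial m c) n :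
              MvPolynomial σ k) = monomial m c :=
            DirectSum.decompose_of_mem_same _ (isWeightedHomogeneous_monomial w m c hmn)
          rw [← h1, ← hh, DirectSum.decompose_sum, DirectSum.sum_apply,
            AddSubmonoidClass.coe_finsetSum]
          refine Finset.sum_congr rfl fun j _ => ?_
          exact DirectSum.coe_decompose_mul_of_right_mem _ n (hG j)
        rw [hcomp]
        refine Submodule.sum_mem _ fun j _ => ?_
        split_ifs with hj
        · have h2 := ih (n - e j) (Nat.sub_lt ((he j).trans_le hj) (he j))
            _ (DirectSum.decompose (weightedHomogeneousSubmodule k w) (h j) (n - e j)).2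
          rw [mul_comm]
          exact Submodule.smul_mem M
            (⟨G j, Algebra.subset_adjoin ⟨j, rfl⟩⟩ : Algebra.adjoin k (Set.range G)) h2
        · exact M.zero_mem
  rw [eq_top_iff]
  intro φ _
  rw [φ.as_sum]
  exact Submodule.sum_mem _ fun m _ => key _ _ (isWeightedHomogeneous_monomial w m _ rfl)

/-- If the origin is the only common zero of quasi-homogeneous polynomials of positive degrees, then
the polynomial ring is finite over the subalgebra they generate: by the Nullstellensatz the ideal
they generate contains a power of each variable. -/
theorem finite_adjoin_of_forall_eval_eq_zero [Field k] [IsAlgClosed k] [Finite σ] {w e : σ → ℕ}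
    {G : σ → MvPolynomial σ k} (he : ∀ j, 0 < e j)
    (hG : ∀ j, (G j).IsWeightedHomogeneous w (e j))
    (h0 : ∀ x : σ → k, (∀ j, eval x (G j) = 0) → x = 0) :
    Module.Finite (Algebra.adjoin k (Set.range G)) (MvPolynomial σ k) := by
  classical
  have hrad : ∀ i, (X i : MvPolynomial σ k) ∈ (Ideal.span (Set.range G)).radical := by
    intro i
    rw [← vanishingIdeal_zeroLocus_eq_radical (K := k), mem_vanishingIdeal_iff]
    intro x hx
    rw [zeroLocus_span] at hx
    have : x = 0 := h0 x fun j => by simpa [aeval_eq_eval] using hx (G j) ⟨j, rfl⟩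
    simp [this]
  choose r hr using hrad
  have := span_monomial_Iic_eq_top he hG (r := Finsupp.equivFunOnFinite.symm r) (by simpa using hr)
  exact ⟨Submodule.fg_def.2 ⟨_, ((Set.finite_Icc 0 _).subset fun m hm => ⟨zero_le, hm⟩).image _, this⟩⟩

end Finiteness

/-! ### The Jacobian determinant and integral equations -/

section Jacobian

/-- A derivation which vanishes on a subalgebra of a characteristic zero domain vanishes on every
element that is integral over it: apply it to the minimal polynomial. -/
theorem derivation_eq_zero_of_isIntegral {k B : Type*} [Field k] [CharZero k] [CommRing B]
    [IsDomain B] [Algebra k B] (A : Subalgebra k B) (D : Derivation k B B)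
    (hD : ∀ a ∈ A, D a = 0) {x : B} (hx : IsIntegral A x) : D x = 0 := by
  let D' : Derivation A B B :=
    { toFun := D
      map_add' := D.map_add
      map_smul' := fun a b => by
        simp [Subalgebra.smul_def, hD a.1 a.2]
      map_one_eq_zero' := D.map_one_eq_zero
      leibniz' := fun a b => D.leibniz a b }
  have h1 : D' (Polynomial.aeval x (minpoly A x)) = _ := D'.map_aeval (minpoly A x) x
  rw [minpoly.aeval, map_zero, smul_eq_mul] at h1
  rcases mul_eq_zero.1 h1.symm with h2 | h2
  · exfalso
    set p := minpoly A x
    have hpos : 0 < p.natDegree := minpoly.natDegree_pos hx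
    have hmonic : p.Monic := minpoly.monic hx
    -- dividing `p'` by its leading coefficient gives a smaller monic polynomial killing `x`
    set q := Polynomial.C (algebraMap k A (p.natDegree : k)⁻¹) * Polynomial.derivative p with hq
    have hn : (p.natDegree : k) ≠ 0 := by exact_mod_cast hpos.ne'
    have hcoeff : q.coeff (p.natDegree - 1) = 1 := by
      rw [hq, Polynomial.coeff_C_mul, Polynomial.coeff_derivative, Nat.sub_add_cancel hpos,
        hmonic.coeff_natDegree, one_mul]
      have : ((p.natDegree - 1 : ℕ) : A) + 1 = algebraMap k A (p.natDegree : k) := by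
        rw [map_natCast, ← Nat.cast_succ, Nat.succ_eq_add_one, Nat.sub_add_cancel hpos]
      rw [this, ← map_mul, inv_mul_cancel₀ hn, map_one]
    have hdeg : q.natDegree ≤ p.natDegree - 1 :=
      (Polynomial.natDegree_C_mul_le _ _).trans (Polynomial.natDegree_derivative_le p)
    have hqm : q.Monic := Polynomial.monic_of_natDegree_le_of_coeff_eq_one _ hdeg hcoeff
    have hq0 : Polynomial.aeval x q = 0 := by rw [hq, map_mul, h2, mul_zero]
    have : p.natDegree ≤ q.natDegree :=
      Polynomial.natDegree_le_natDegree (minpoly.min A x hqm hq0)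
    omega
  · exact h2

theorem coeff_zero_minpoly_ne_zero {A B : Type*} [CommRing A] [CommRing B] [IsDomain B]
    [Algebra A B] {x : B} (hx : IsIntegral A x) (h0 : x ≠ 0) : (minpoly A x).coeff 0 ≠ 0 := by
  intro hc
  have : Nontrivial A := (algebraMap A B).domain_nontrivial
  have hp : minpoly A x = (minpoly A x).divX * Polynomial.X := by
    conv_lhs => rw [← Polynomial.divX_mul_X_add (minpoly A x), hc, map_zero, add_zero]
  have hm : (minpoly A x).divX.Monic :=
    Polynomial.Monic.of_mul_monic_right Polynomial.monic_X
      (by rw [← hp]; exact minpoly.monic hx)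
  have hr : Polynomial.aeval x (minpoly A x).divX = 0 := by
    have h := minpoly.aeval A x
    rw [hp, map_mul, Polynomial.aeval_X] at h
    exact (mul_eq_zero.1 h).resolve_right h0
  have hle := Polynomial.natDegree_le_natDegree (minpoly.min A x hm hr)
  rw [Polynomial.natDegree_divX_eq_natDegree_tsub_one] at hle
  have := minpoly.natDegree_pos hx
  omega

variable {N : ℕ}

theorem eval_comp_aeval (G : Fin N → MvPolynomial (Fin N) ℂ) (x : Fin N → ℂ) :
    (eval x).comp (aeval G : MvPolynomial (Fin N) ℂ →ₐ[ℂ] MvPolynomial (Fin N) ℂ).toRingHom =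
      eval fun j => eval x (G j) := by
  apply ringHom_ext <;> simp

/-- The (transposed) Jacobian matrix of a polynomial map `ℂ^N → ℂ^N`. -/
noncomputable def jacobian (G : Fin N → MvPolynomial (Fin N) ℂ) :
    Matrix (Fin N) (Fin N) (MvPolynomial (Fin N) ℂ) :=
  Matrix.of fun i j => pderiv i (G j)

/-- A vector `v` in the left kernel of the Jacobian matrix over the polynomial ring is a derivation
`∑ vᵢ ∂ᵢ` that kills all components of `G`, hence all elements integral over them. -/
theorem det_jacobian_ne_zero {G : Fin N → MvPolynomial (Fin N) ℂ}
    [Algebra.IsIntegral (Algebra.adjoin ℂ (Set.range G)) (MvPolynomial (Fin N) ℂ)] :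
    (jacobian G).det ≠ 0 := by
  intro hdet
  obtain ⟨v, hv, hvG⟩ := Matrix.exists_vecMul_eq_zero_iff.2 hdet
  refine hv (funext fun i => ?_)
  set D : Derivation ℂ (MvPolynomial (Fin N) ℂ) (MvPolynomial (Fin N) ℂ) :=
    ∑ i, v i • pderiv i with hDdef
  have hDa : ∀ p, D p = ∑ i, v i * pderiv i p := fun p => by
    rw [hDdef, ← Derivation.coeFnAddMonoidHom_apply, map_sum, Finset.sum_apply]
    rfl
  have hDG : ∀ a ∈ Algebra.adjoin ℂ (Set.range G), D a = 0 := by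
    have : Set.EqOn D (0 : Derivation ℂ _ _) (Set.range G) := by
      rintro _ ⟨j, rfl⟩
      rw [hDa]
      exact congrFun hvG j
    exact fun a ha => Derivation.eqOn_adjoin this ha
  have h := derivation_eq_zero_of_isIntegral _ D hDG
    (Algebra.IsIntegral.isIntegral (R := Algebra.adjoin ℂ (Set.range G)) (X i))
  rw [hDa, Finset.sum_eq_single i (fun j _ hj => by simp [pderiv_X_of_ne hj.symm]) (by simp),
    pderiv_X_self, mul_one] at h
  exact h

/-- The critical values of a finite polynomial map are contained in a hypersurface: the constant
coefficient of the minimal polynomial of the Jacobian determinant `J` over the subalgebra generated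
by the components vanishes wherever `J` does. -/
theorem exists_eval_eq_zero_of_det_jacobian_eq_zero {G : Fin N → MvPolynomial (Fin N) ℂ}
    [Algebra.IsIntegral (Algebra.adjoin ℂ (Set.range G)) (MvPolynomial (Fin N) ℂ)] :
    ∃ g : MvPolynomial (Fin N) ℂ, g ≠ 0 ∧ ∀ x : Fin N → ℂ,
      eval x (jacobian G).det = 0 → eval (fun j => eval x (G j)) g = 0 := by
  set A := Algebra.adjoin ℂ (Set.range G)
  set J := (jacobian G).det
  have hJ : IsIntegral A J := Algebra.IsIntegral.isIntegral J
  have hc := coeff_zero_minpoly_ne_zero hJ det_jacobian_ne_zero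
  set a := (minpoly A J).coeff 0 with ha
  have haR : (a : MvPolynomial (Fin N) ℂ) ∈ (aeval G : MvPolynomial (Fin N) ℂ →ₐ[ℂ] _).range := by
    rw [← Algebra.adjoin_range_eq_range_aeval]
    exact a.2
  obtain ⟨g, hg⟩ := haR
  have hgx : ∀ x : Fin N → ℂ, eval (fun j => eval x (G j)) g = eval x (a : MvPolynomial _ ℂ) := by
    intro x
    rw [← hg, ← eval_comp_aeval]
    rfl
  refine ⟨g, ?_, fun x hx => ?_⟩
  · rintro rfl
    rw [map_zero] at hg
    exact hc (Subtype.ext hg.symm)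
  · have h0 := minpoly.aeval A J
    rw [← Polynomial.divX_mul_X_add (minpoly A J), map_add, map_mul, Polynomial.aeval_X,
      Polynomial.aeval_C, ← ha] at h0
    have h1 := congrArg (eval x) h0
    rw [map_add, map_mul, hx, mul_zero, zero_add, map_zero] at h1
    rw [hgx]
    exact h1

/-- Every coordinate satisfies a monic equation whose coefficients are polynomials in `G x`. -/
theorem exists_monic_isRoot {G : Fin N → MvPolynomial (Fin N) ℂ}
    [Algebra.IsIntegral (Algebra.adjoin ℂ (Set.range G)) (MvPolynomial (Fin N) ℂ)] (i : Fin N) :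
    ∃ p : Polynomial (MvPolynomial (Fin N) ℂ), p.Monic ∧ ∀ x : Fin N → ℂ,
      (p.map (eval fun j => eval x (G j))).IsRoot (x i) := by
  have hint : (aeval G : MvPolynomial (Fin N) ℂ →ₐ[ℂ] MvPolynomial (Fin N) ℂ).toRingHom.IsIntegral := by
    have h1 : (algebraMap (Algebra.adjoin ℂ (Set.range G)) (MvPolynomial (Fin N) ℂ)).IsIntegral :=
      fun y => Algebra.IsIntegral.isIntegral y
    rw [Algebra.adjoin_range_eq_range_aeval] at h1
    exact (RingHom.isIntegral_of_surjective _ (aeval G).rangeRestrict_surjective).trans _ _ h1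
  obtain ⟨p, hp, h0⟩ := hint (X i)
  refine ⟨p, hp, fun x => ?_⟩
  have h1 := congrArg (eval x) h0
  rw [Polynomial.hom_eval₂, map_zero, eval_X, eval_comp_aeval] at h1
  rw [Polynomial.IsRoot, Polynomial.eval_map]
  exact h1

end Jacobian

/-! ### Polynomial maps: differentiability, properness, finite fibres -/

section PolynomialMap

variable {N : ℕ}

/-- The map `ℂ^N → ℂ^N` with polynomial components `G j`. -/
noncomputable def polyMap (G : Fin N → MvPolynomial (Fin N) ℂ) (x : Fin N → ℂ) : Fin N → ℂ :=
  fun j => eval x (G j)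

theorem contDiff_eval (P : MvPolynomial (Fin N) ℂ) :
    ContDiff ℂ ∞ fun x : Fin N → ℂ => eval x P :=
  (AnalyticOnNhd.eval_mvPolynomial P).contDiff

theorem continuous_eval_point (P : MvPolynomial (Fin N) ℂ) :
    Continuous fun x : Fin N → ℂ => eval x P :=
  (contDiff_eval P).continuous

theorem contDiff_polyMap (G : Fin N → MvPolynomial (Fin N) ℂ) : ContDiff ℂ ∞ (polyMap G) :=
  contDiff_pi.2 fun j => contDiff_eval (G j)

theorem hasFDerivAt_eval (P : MvPolynomial (Fin N) ℂ) (x : Fin N → ℂ) :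
    HasFDerivAt (fun x : Fin N → ℂ => eval x P)
      (∑ i, eval x (pderiv i P) • (ContinuousLinearMap.proj i : (Fin N → ℂ) →L[ℂ] ℂ)) x := by
  induction P using MvPolynomial.induction_on with
  | C a =>
    simp only [eval_C]
    refine (hasFDerivAt_const a x).congr_fderiv ?_
    ext v
    simp
  | add p q hp hq =>
    simp only [map_add]
    refine (hp.add hq).congr_fderiv ?_
    ext v
    simp [add_mul, Finset.sum_add_distrib]
  | mul_X p i hp =>
    simp only [map_mul, eval_X]
    refine (hp.mul (hasFDerivAt_apply i x)).congr_fderiv ?_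
    ext v
    simp [pderiv_X, Pi.single_apply, add_mul, Finset.sum_add_distrib, Finset.mul_sum, mul_assoc,
      apply_ite (eval x)]

/-- Where the Jacobian determinant does not vanish, the derivative is invertible. -/
theorem exists_hasFDerivAt_equiv {G : Fin N → MvPolynomial (Fin N) ℂ} {x : Fin N → ℂ}
    (hx : eval x (jacobian G).det ≠ 0) :
    ∃ L : (Fin N → ℂ) ≃L[ℂ] (Fin N → ℂ),
      HasFDerivAt (polyMap G) (L : (Fin N → ℂ) →L[ℂ] (Fin N → ℂ)) x := by
  set L₀ : (Fin N → ℂ) →L[ℂ] (Fin N → ℂ) := ContinuousLinearMap.pi fun j =>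
    ∑ i, eval x (pderiv i (G j)) • (ContinuousLinearMap.proj i : (Fin N → ℂ) →L[ℂ] ℂ) with hL₀
  have hinj : Function.Injective L₀ := by
    rw [injective_iff_map_eq_zero]
    intro v hv
    refine Matrix.eq_zero_of_vecMul_eq_zero (M := (jacobian G).map (eval x)) ?_ ?_
    · rwa [← RingHom.mapMatrix_apply, ← RingHom.map_det]
    · rw [← hv]
      ext j
      simp [hL₀, Matrix.vecMul, dotProduct, jacobian, mul_comm]
  refine ⟨(LinearEquiv.ofInjectiveEndo (L₀ : (Fin N → ℂ) →ₗ[ℂ] (Fin N → ℂ))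
    hinj).toContinuousLinearEquiv, ?_⟩
  have : ((LinearEquiv.ofInjectiveEndo (L₀ : (Fin N → ℂ) →ₗ[ℂ] (Fin N → ℂ))
    hinj).toContinuousLinearEquiv : (Fin N → ℂ) →L[ℂ] (Fin N → ℂ)) = L₀ := by
    ext v; rfl
  rw [this]
  exact hasFDerivAt_pi.2 fun j => hasFDerivAt_eval (G j) x

variable {G : Fin N → MvPolynomial (Fin N) ℂ}
    [Algebra.IsIntegral (Algebra.adjoin ℂ (Set.range G)) (MvPolynomial (Fin N) ℂ)]

/-- The coordinates of `x` are bounded in terms of `G x`: they are roots of monic polynomials with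
coefficients depending continuously on `G x`, to which Cauchy's bound applies. -/
theorem exists_continuous_norm_le (i : Fin N) :
    ∃ β : (Fin N → ℂ) → ℝ, Continuous β ∧ ∀ x, ‖x i‖ ≤ β (polyMap G x) := by
  obtain ⟨p, hp, hroot⟩ := exists_monic_isRoot (G := G) i
  refine ⟨fun y => ∑ k ∈ Finset.range p.natDegree, ‖eval y (p.coeff k)‖ + 1, ?_, fun x => ?_⟩
  · exact (continuous_finsetSum _ fun k _ => (continuous_eval_point _).norm).add continuous_const
  · have hm : (p.map (eval (polyMap G x))).Monic := hp.map _
    have h := (hroot x).norm_lt_cauchyBound hm.ne_zero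
    refine (NNReal.coe_le_coe.2 h.le).trans ?_
    rw [Polynomial.cauchyBound, hm.leadingCoeff, nnnorm_one, div_one, hp.natDegree_map,
      NNReal.coe_add, NNReal.coe_one]
    refine add_le_add_left ?_ 1
    have : (Finset.range p.natDegree).sup (fun k => ‖(p.map (eval (polyMap G x))).coeff k‖₊) ≤
        ∑ k ∈ Finset.range p.natDegree, ‖eval (polyMap G x) (p.coeff k)‖₊ := by
      refine Finset.sup_le fun k hk => ?_
      rw [Polynomial.coeff_map]
      exact Finset.single_le_sum (f := fun k => ‖eval (polyMap G x) (p.coeff k)‖₊)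
        (fun _ _ => zero_le) hk
    exact (NNReal.coe_le_coe.2 this).trans_eq (by rw [NNReal.coe_sum]; rfl)

theorem isProperMap_polyMap : IsProperMap (polyMap G) := by
  rw [isProperMap_iff_isCompact_preimage]
  refine ⟨(contDiff_polyMap G).continuous, fun K hK => ?_⟩
  refine Metric.isCompact_of_isClosed_isBounded
    (hK.isClosed.preimage (contDiff_polyMap G).continuous) ?_
  choose β hβ hle using fun i => exists_continuous_norm_le (G := G) i
  choose c hc using fun i => hK.bddAbove_image (hβ i).continuousOn
  refine (isBounded_iff_forall_norm_le.2 ⟨∑ i, |c i|, fun x hx => ?_⟩)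
  rw [pi_norm_le_iff_of_nonneg (Finset.sum_nonneg fun _ _ => abs_nonneg _)]
  intro i
  calc ‖x i‖ ≤ β i (polyMap G x) := hle i x
    _ ≤ c i := hc i ⟨_, hx, rfl⟩
    _ ≤ |c i| := le_abs_self _
    _ ≤ _ := Finset.single_le_sum (f := fun i => |c i|) (fun _ _ => abs_nonneg _)
      (Finset.mem_univ i)

theorem finite_fiber_polyMap (y : Fin N → ℂ) : {x | polyMap G x = y}.Finite := by
  choose p hp hroot using fun i => exists_monic_isRoot (G := G) i
  refine (Set.Finite.pi' fun i => Polynomial.finite_setOfPred_isRoot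
    ((hp i).map (eval y)).ne_zero).subset ?_
  rintro x rfl i
  exact hroot i x

end PolynomialMap

/-! ### Smooth sections and finite trivializing covers -/

section Sections

/-- Over `V` the fibres of `F` consist of `n` distinct points depending smoothly on the base
point. -/
def HasSmoothSections {E : Type*} [NormedAddCommGroup E] [NormedSpace ℂ E] (F : E → E) (n : ℕ)
    (V : Set E) : Prop :=
  ∃ κ : Fin n → E → E, (∀ i, ContDiffOn ℂ ∞ (κ i) V) ∧
    ∀ b ∈ V, Function.Injective (fun i => κ i b) ∧ ∀ x, F x = b ↔ ∃ i, κ i b = x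

variable {E : Type*} [NormedAddCommGroup E] [NormedSpace ℂ E] {F : E → E} {n : ℕ}

theorem HasSmoothSections.mono {U V : Set E} (hV : HasSmoothSections F n V) (hUV : U ⊆ V) :
    HasSmoothSections F n U := by
  obtain ⟨κ, hκ, h⟩ := hV
  exact ⟨κ, fun i => (hκ i).mono hUV, fun b hb => h b (hUV hb)⟩

theorem HasSmoothSections.sUnion {𝒮 : Set (Set E)}
    (h𝒮 : ∀ B ∈ 𝒮, IsOpen B ∧ HasSmoothSections F n B) (hd : 𝒮.PairwiseDisjoint id) :
    HasSmoothSections F n (⋃₀ 𝒮) := by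
  classical
  choose! κ hκ hfib using fun B hB => (h𝒮 B hB).2
  choose! B hB hbB using fun b (hb : b ∈ ⋃₀ 𝒮) => hb
  have hBeq : ∀ C ∈ 𝒮, ∀ b ∈ C, B b = C := fun C hC b hb =>
    hd.elim_set (hB b ⟨C, hC, hb⟩) hC b (hbB b ⟨C, hC, hb⟩) hb
  refine ⟨fun i b => κ (B b) i b, fun i => ?_, fun b hb => hfib (B b) (hB b hb) b (hbB b hb)⟩
  rintro b ⟨C, hC, hb⟩
  have hCn : C ∈ 𝓝 b := (h𝒮 C hC).1.mem_nhds hb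
  refine (((hκ C hC i).contDiffAt hCn).congr_of_eventuallyEq ?_).contDiffWithinAt
  filter_upwards [hCn] with c hc
  rw [hBeq C hC c hc]

theorem HasSmoothSections.natCard_fiber {V : Set E} (hV : HasSmoothSections F n V) {b : E}
    (hb : b ∈ V) : Nat.card {x // F x = b} = n := by
  obtain ⟨κ, -, h⟩ := hV
  obtain ⟨hinj, hfib⟩ := h b hb
  have : Function.Bijective fun i : Fin n =>
      (⟨κ i b, (hfib _).2 ⟨i, rfl⟩⟩ : {x // F x = b}) :=
    ⟨fun i j hij => hinj (congrArg Subtype.val hij), fun x => by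
      obtain ⟨i, hi⟩ := (hfib x).1 x.2
      exact ⟨i, Subtype.ext hi⟩⟩
  rw [← Nat.card_eq_of_bijective _ this, Nat.card_fin]

/-- A property of open sets that passes to open subsets and to disjoint unions and that holds
locally on `R` holds on each member of a finite open cover of `R`. By the Besicovitch covering
theorem, `R` is covered by finitely many disjoint families of small balls. -/
theorem exists_finite_open_cover {E : Type*} [NormedAddCommGroup E] [NormedSpace ℝ E]
    [FiniteDimensional ℝ E] {P : Set E → Prop} (hmono : ∀ U V, IsOpen U → U ⊆ V → P V → P U)
    (hunion : ∀ 𝒮 : Set (Set E), (∀ B ∈ 𝒮, IsOpen B ∧ P B) → 𝒮.PairwiseDisjoint id → P (⋃₀ 𝒮))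
    {R : Set E} (hR : ∀ p ∈ R, ∃ V, IsOpen V ∧ p ∈ V ∧ V ⊆ R ∧ P V) :
    ∃ (m : ℕ) (U : Fin m → Set E), (∀ k, IsOpen (U k) ∧ P (U k)) ∧ R = ⋃ k, U k := by
  obtain ⟨m, τ, hτ, hm⟩ := HasBesicovitchCovering.no_satelliteConfig (α := E)
  have hball : ∀ p : R, ∃ r : ℝ, 0 < r ∧ r ≤ 1 ∧ Metric.ball (p : E) r ⊆ R ∧
      P (Metric.ball (p : E) r) := by
    rintro ⟨p, hp⟩
    obtain ⟨V, hVo, hpV, hVR, hPV⟩ := hR p hp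
    obtain ⟨r, hr, hrV⟩ := Metric.isOpen_iff.1 hVo p hpV
    have hsub : Metric.ball p (min r 1) ⊆ V :=
      (Metric.ball_subset_ball (min_le_left _ _)).trans hrV
    exact ⟨min r 1, lt_min hr one_pos, min_le_right _ _, hsub.trans hVR,
      hmono _ _ Metric.isOpen_ball hsub hPV⟩
  choose r hr0 hr1 hrR hrP using hball
  obtain ⟨s, hsd, hs⟩ := Besicovitch.exist_disjoint_covering_families hτ hm
    (⟨Subtype.val, r, hr0, 1, hr1⟩ : Besicovitch.BallPackage R E)
  refine ⟨m, fun k => ⋃₀ ((fun p : R => Metric.ball (p : E) (r p)) '' s k),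
    fun k => ⟨?_, hunion _ ?_ ?_⟩, Set.Subset.antisymm ?_ ?_⟩
  · refine isOpen_sUnion ?_
    rintro _ ⟨p, -, rfl⟩
    exact Metric.isOpen_ball
  · rintro _ ⟨p, -, rfl⟩
    exact ⟨Metric.isOpen_ball, hrP p⟩
  · rintro _ ⟨p, hp, rfl⟩ _ ⟨q, hq, rfl⟩ hpq
    have hne : p ≠ q := fun h => hpq (by rw [h])
    exact (hsd k hp hq hne).mono Metric.ball_subset_closedBall Metric.ball_subset_closedBall
  · intro x hx
    have := hs ⟨⟨x, hx⟩, rfl⟩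
    simp only [Set.mem_iUnion] at this
    obtain ⟨k, p, hp, hxp⟩ := this
    exact Set.mem_iUnion.2 ⟨k, _, ⟨p, hp, rfl⟩, hxp⟩
  · refine Set.iUnion_subset fun k => Set.sUnion_subset ?_
    rintro _ ⟨p, -, rfl⟩
    exact hrR p

end Sections

/-! ### The regular values of a finite polynomial map -/

section RegularValues

variable {N : ℕ}

/-- The set of values of a polynomial map over which the Jacobian determinant does not vanish. -/
def regularValues (G : Fin N → MvPolynomial (Fin N) ℂ) : Set (Fin N → ℂ) :=
  {b | ∀ x, polyMap G x = b → eval x (jacobian G).det ≠ 0}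

variable {G : Fin N → MvPolynomial (Fin N) ℂ}
    [Algebra.IsIntegral (Algebra.adjoin ℂ (Set.range G)) (MvPolynomial (Fin N) ℂ)]

/-- Each of the finitely many points over `p` continues to a smooth local section, by the inverse
function theorem; since the map is proper, no other points occur over nearby values. -/
theorem exists_hasSmoothSections {p : Fin N → ℂ} (hp : p ∈ regularValues G) :
    ∃ V, IsOpen V ∧ p ∈ V ∧ V ⊆ regularValues G ∧
      HasSmoothSections (polyMap G) (Nat.card {x // polyMap G x = p}) V := by
  have hfin : Finite {x // polyMap G x = p} := finite_fiber_polyMap p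
  obtain ⟨T, hT, hTd⟩ := (finite_fiber_polyMap (G := G) p).t2_separation
  choose L hL using fun x : {x // polyMap G x = p} => exists_hasFDerivAt_equiv (hp x.1 x.2)
  let e : {x // polyMap G x = p} → OpenPartialHomeomorph (Fin N → ℂ) (Fin N → ℂ) := fun x =>
    (contDiff_polyMap G).contDiffAt.toOpenPartialHomeomorph (polyMap G) (hL x) (by simp)
  have hex : ∀ x : {x // polyMap G x = p}, x.1 ∈ (e x).source := fun x =>
    (contDiff_polyMap G).contDiffAt.mem_toOpenPartialHomeomorph_source (hL x) (by simp)
  have hJo : IsOpen {z : Fin N → ℂ | eval z (jacobian G).det ≠ 0} :=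
    isOpen_ne_fun (continuous_eval_point _) continuous_const
  -- disjoint neighbourhoods of the points over `p` on which the map is a local diffeomorphism
  let S : {x // polyMap G x = p} → Set (Fin N → ℂ) := fun x =>
    (e x).source ∩ (T x ∩ {z | eval z (jacobian G).det ≠ 0})
  have hSo : ∀ x, IsOpen (S x) := fun x => (e x).open_source.inter ((hT x).2.inter hJo)
  have hxS : ∀ x, x.1 ∈ S x := fun x => ⟨hex x, (hT x).1, hp x.1 x.2⟩
  have hSimg : ∀ x, IsOpen (polyMap G '' S x) := fun x =>
    (e x).isOpen_image_of_subset_source (hSo x) Set.inter_subset_left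
  let V : Set (Fin N → ℂ) := (⋂ x, polyMap G '' S x) ∩ (polyMap G '' (⋃ x, S x)ᶜ)ᶜ
  have hVS : ∀ b ∈ V, ∀ z, polyMap G z = b → ∃ x, z ∈ S x := by
    rintro b ⟨-, hb⟩ z rfl
    by_contra! hz
    exact hb ⟨z, by simpa using hz, rfl⟩
  have hsymm : ∀ b ∈ V, ∀ x, (e x).symm b ∈ S x ∧ polyMap G ((e x).symm b) = b := by
    intro b hb x
    obtain ⟨z, hz, rfl⟩ := Set.mem_iInter.1 hb.1 x
    have : (e x).symm (polyMap G z) = z := (e x).left_inv hz.1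
    rw [this]
    exact ⟨hz, rfl⟩
  refine ⟨V, ?_, ⟨?_, ?_⟩, ?_, ?_⟩
  · exact (isOpen_iInter_of_finite hSimg).inter
      (isProperMap_polyMap.isClosedMap _ (isOpen_iUnion hSo).isClosed_compl).isOpen_compl
  · exact Set.mem_iInter.2 fun x => ⟨x.1, hxS x, x.2⟩
  · rintro ⟨z, hz, hzp⟩
    exact hz (Set.mem_iUnion.2 ⟨⟨z, hzp⟩, hxS _⟩)
  · intro b hb z hz
    obtain ⟨x, hx⟩ := hVS b hb z hz
    exact hx.2.2
  · let ε := (Finite.equivFin {x // polyMap G x = p}).symm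
    refine ⟨fun i => (e (ε i)).symm, fun i b hb => ?_, fun b hb => ⟨fun i j hij => ?_, fun z =>
      ⟨fun hz => ?_, ?_⟩⟩⟩
    · obtain ⟨hS, hG⟩ := hsymm b hb (ε i)
      obtain ⟨L', hL'⟩ := exists_hasFDerivAt_equiv hS.2.2
      have hbt : b ∈ (e (ε i)).target := by
        rw [← hG]
        exact (e (ε i)).map_source hS.1
      exact ((e (ε i)).contDiffAt_symm hbt hL'
        (contDiff_polyMap G).contDiffAt).contDiffWithinAt
    · by_contra hne
      have hne' : (ε i).1 ≠ (ε j).1 := fun h => hne (ε.injective (Subtype.ext h))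
      have h1 := (hsymm b hb (ε i)).1.2.1
      have h2 := (hsymm b hb (ε j)).1.2.1
      have hij' : (e (ε i)).symm b = (e (ε j)).symm b := hij
      rw [hij'] at h1
      exact Set.disjoint_left.1 (hTd (ε i).2 (ε j).2 hne') h1 h2
    · obtain ⟨x, hx⟩ := hVS b hb z hz
      refine ⟨ε.symm x, ?_⟩
      change (e (ε (ε.symm x))).symm b = z
      rw [ε.apply_symm_apply, ← hz]
      exact (e x).left_inv hx.1
    · rintro ⟨i, rfl⟩
      exact (hsymm b hb (ε i)).2

theorem isOpen_regularValues : IsOpen (regularValues G) := by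
  rw [isOpen_iff_mem_nhds]
  intro p hp
  obtain ⟨V, hVo, hpV, hVR, -⟩ := exists_hasSmoothSections hp
  exact Filter.mem_of_superset (hVo.mem_nhds hpV) hVR

/-- A regular value is joined to a fixed point `c` off the hypersurface containing the critical
values inside the complex line through both, which meets that hypersurface in a finite set. -/
theorem isPathConnected_regularValues : IsPathConnected (regularValues G) := by
  obtain ⟨g, hg, hgJ⟩ := exists_eval_eq_zero_of_det_jacobian_eq_zero (G := G)
  have hreg : ∀ b, eval b g ≠ 0 → b ∈ regularValues G := by
    rintro _ hb x rfl hx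
    exact hb (hgJ x hx)
  obtain ⟨c, hc⟩ : ∃ c, eval c g ≠ 0 := by
    by_contra! h
    exact hg (funext fun c => by simpa using h c)
  refine ⟨c, hreg c hc, fun {p} hp => ?_⟩
  let h : Polynomial ℂ :=
    aeval (fun i => Polynomial.C (p i) + Polynomial.X * Polynomial.C (c i - p i)) g
  let ℓ : ℂ → Fin N → ℂ := fun t i => p i + t * (c i - p i)
  have hh : ∀ t, h.eval t = eval (ℓ t) g := by
    intro t
    have : (Polynomial.evalRingHom t).comp (aeval (R := ℂ) fun i => Polynomial.C (p i) +
        Polynomial.X * Polynomial.C (c i - p i)).toRingHom = eval (ℓ t) := by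
      apply ringHom_ext <;> simp [ℓ]
    rw [← this]
    rfl
  have hℓ0 : ℓ 0 = p := by ext i; simp [ℓ]
  have hℓ1 : ℓ 1 = c := by ext i; simp [ℓ]
  have hh0 : h ≠ 0 := by
    intro h0
    apply hc
    rw [← hℓ1, ← hh, h0, Polynomial.eval_zero]
  -- the parameter `t = 0` is kept: it gives the regular value `p` even if `g` vanishes there
  have hfin : ({t | h.IsRoot t} \ {0}).Finite := (Polynomial.finite_setOfPred_isRoot hh0).sdiff
  have hpc := hfin.countable.isPathConnected_compl_of_one_lt_rank
    (by rw [Complex.rank_real_complex]; norm_num)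
  have h1 : (1 : ℂ) ∈ ({t | h.IsRoot t} \ {0})ᶜ := by
    rintro ⟨h1, -⟩
    apply hc
    rw [← hℓ1, ← hh]
    exact h1
  have h0 : (0 : ℂ) ∈ ({t | h.IsRoot t} \ {0})ᶜ := fun h => h.2 rfl
  have hj := hpc.joinedIn 1 h1 0 h0
  have hcont : Continuous ℓ := by fun_prop
  have := hj.map_continuousOn (f := ℓ) hcont.continuousOn
  rw [hℓ0, hℓ1] at this
  refine this.mono ?_
  rintro _ ⟨t, ht, rfl⟩
  by_cases ht0 : t = 0
  · rw [ht0, hℓ0]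
    exact hp
  · refine hreg _ fun hz => ht ⟨?_, ht0⟩
    rw [← hh] at hz
    exact hz

/-- The degree of the covering of the regular values is constant, so that finitely many
trivializing open sets suffice. -/
theorem exists_finite_cover_hasSmoothSections :
    ∃ (n m : ℕ) (U : Fin m → Set (Fin N → ℂ)),
      (∀ k, IsOpen (U k) ∧ HasSmoothSections (polyMap G) n (U k)) ∧
      regularValues G = ⋃ k, U k := by
  obtain ⟨c, hc⟩ := (isPathConnected_regularValues (G := G)).nonempty
  have hcont : ContinuousOn (fun b => Nat.card {x // polyMap G x = b}) (regularValues G) := by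
    intro p hp
    obtain ⟨V, hVo, hpV, -, hV⟩ := exists_hasSmoothSections hp
    refine (continuousAt_const (y := Nat.card {x // polyMap G x = p}).congr
      ?_).continuousWithinAt
    filter_upwards [hVo.mem_nhds hpV] with b hb
    exact (hV.natCard_fiber hb).symm
  have hconst : ∀ p ∈ regularValues G,
      Nat.card {x // polyMap G x = p} = Nat.card {x // polyMap G x = c} := fun p hp =>
    (isPathConnected_regularValues (G := G)).isConnected.isPreconnected.constant hcont hp hc
  refine ⟨Nat.card {x // polyMap G x = c}, exists_finite_open_cover
    (fun U V _ hUV hV => hV.mono hUV) (fun 𝒮 h𝒮 hd => HasSmoothSections.sUnion h𝒮 hd)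
    fun p hp => ?_⟩
  rw [← hconst p hp]
  exact exists_hasSmoothSections hp

end RegularValues

variable {N : ℕ}

/-! ### The gradient map of a quasi-homogeneous polynomial -/

section Gradient

/-- The negative gradient of `W`: its value at `x` is the unique `b` for which `x` is a critical
point of `W + ∑ i, b i * x i`. -/
noncomputable def negGradient (W : MvPolynomial (Fin N) ℂ) (j : Fin N) : MvPolynomial (Fin N) ℂ :=
  -pderiv j W

theorem eval_pderiv_perturbed (W : MvPolynomial (Fin N) ℂ) (b x : Fin N → ℂ) (i : Fin N) :
    eval x (pderiv i (perturbed W b)) = eval x (pderiv i W) + b i := by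
  simp [perturbed, pderiv_X, Pi.single_apply]

theorem eval_perturbed (W : MvPolynomial (Fin N) ℂ) (b x : Fin N → ℂ) :
    eval x (perturbed W b) = eval x W + ∑ i, b i * x i := by
  simp [perturbed]

theorem isCriticalPoint_perturbed_iff {W : MvPolynomial (Fin N) ℂ} {b x : Fin N → ℂ} :
    IsCriticalPoint (perturbed W b) x ↔ polyMap (negGradient W) x = b := by
  simp only [IsCriticalPoint, eval_pderiv_perturbed, funext_iff, polyMap, negGradient, map_neg]
  exact forall_congr' fun i => by rw [neg_eq_iff_add_eq_zero]

theorem det_hessian_perturbed (W : MvPolynomial (Fin N) ℂ) (b x : Fin N → ℂ) :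
    (hessian (perturbed W b) x).det =
      (-1) ^ N * eval x (jacobian (negGradient W)).det := by
  have h1 : hessian (perturbed W b) x = -((jacobian (negGradient W)).map (eval x)) := by
    ext i j
    simp only [hessian, perturbed, jacobian, negGradient, Matrix.of_apply, Matrix.neg_apply,
      Matrix.map_apply, map_neg, neg_neg, map_add, map_sum, pderiv_C_mul, pderiv_X]
    simp [Pi.single_apply, apply_ite (pderiv i)]
  rw [h1, Matrix.det_neg, Fintype.card_fin, ← RingHom.mapMatrix_apply, ← RingHom.map_det]

theorem regularSet_eq (W : MvPolynomial (Fin N) ℂ) :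
    regularSet W = regularValues (negGradient W) := by
  ext b
  simp [regularSet, IsHolomorphicMorse, regularValues, isCriticalPoint_perturbed_iff,
    det_hessian_perturbed]

/-- A partial derivative of a quasi-homogeneous polynomial that vanishes at the origin is
quasi-homogeneous of positive degree: either `w j < d` and its degree is `d - w j`, or it is zero and
homogeneous of every degree. -/
theorem exists_isWeightedHomogeneous_negGradient {W : MvPolynomial (Fin N) ℂ}
    {w : Fin N → ℕ} {d : ℕ} (hw : ∀ i, 0 < w i) (hW : W.IsWeightedHomogeneous w d)
    {j : Fin N} (h0 : eval 0 (pderiv j W) = 0) :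
    ∃ e, 0 < e ∧ (negGradient W j).IsWeightedHomogeneous w e := by
  have hneg : ∀ e, (pderiv j W).IsWeightedHomogeneous w e →
      (negGradient W j).IsWeightedHomogeneous w e := fun e h =>
    (weightedHomogeneousSubmodule ℂ w e).neg_mem h
  rcases lt_or_ge (w j) d with hjd | hjd
  · exact ⟨d - w j, Nat.sub_pos_of_lt hjd, hneg _ (hW.pderiv (Nat.sub_add_cancel hjd.le))⟩
  · refine ⟨1, one_pos, hneg _ ?_⟩
    have : pderiv j W = 0 := by
      ext m
      rw [coeff_zero]
      by_cases hm : m = 0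
      · rw [hm, ← constantCoeff_eq, ← eval_zero, h0]
      · rw [coeff_pderiv]
        by_contra hne
        have h1 := hW (left_ne_zero_of_mul hne)
        rw [map_add, Finsupp.weight_single, one_smul] at h1
        obtain ⟨i, hi⟩ := Finsupp.ne_iff.1 hm
        have h2 := Finsupp.le_weight w (hw i).ne' m
        have h3 : 0 < m i := Nat.pos_of_ne_zero hi
        omega
    rw [this]
    exact isWeightedHomogeneous_zero ℂ w 1

theorem isIntegral_adjoin_negGradient {W : MvPolynomial (Fin N) ℂ} (hW : IsQuasiHomogeneous W)
    (hnd : IsNondegenerate W) :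
    Algebra.IsIntegral (Algebra.adjoin ℂ (Set.range (negGradient W)))
      (MvPolynomial (Fin N) ℂ) := by
  obtain ⟨w, d, hw, -, hWd⟩ := hW
  choose e he hG using fun j =>
    exists_isWeightedHomogeneous_negGradient hw hWd ((hnd 0).2 rfl j)
  have := finite_adjoin_of_forall_eval_eq_zero he hG fun x hx => (hnd x).1 fun i => by
    simpa [negGradient] using hx i
  exact Algebra.IsIntegral.of_finite _ _

end Gradient

/-! ### Equations of the walls -/

section Wall

/-- Along a section of critical points, the derivative of the critical value with respect to the
linear perturbation is the critical point itself: the contribution of the motion of the critical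
point vanishes. -/
theorem hasFDerivAt_criticalValue {W : MvPolynomial (Fin N) ℂ}
    {κ : (Fin N → ℂ) → (Fin N → ℂ)} {b : Fin N → ℂ} (hκ : DifferentiableAt ℂ κ b)
    (hb : polyMap (negGradient W) (κ b) = b) :
    HasFDerivAt (fun b => eval (κ b) (perturbed W b))
      (∑ i, κ b i • (ContinuousLinearMap.proj i : (Fin N → ℂ) →L[ℂ] ℂ)) b := by
  simp only [eval_perturbed]
  have h1 := (hasFDerivAt_eval W (κ b)).comp b hκ.hasFDerivAt
  have h2 := HasFDerivAt.fun_sum (u := Finset.univ) fun i _ =>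
    (hasFDerivAt_apply (𝕜 := ℂ) i b).mul ((hasFDerivAt_pi'.1 hκ.hasFDerivAt) i)
  refine (h1.add h2).congr_fderiv ?_
  ext v
  have hcrit : ∀ i, eval (κ b) (pderiv i W) = -b i := fun i => by
    have := congrFun hb i
    simp only [polyMap, negGradient, map_neg] at this
    rw [← this, neg_neg]
  simp [hcrit, Finset.sum_add_distrib]

/-- Where there are smooth sections of critical points, the wall is cut out by the imaginary parts of
the differences of their critical values. The differentials of these functions vanish nowhere since
the sections are pairwise distinct everywhere. -/
theorem exists_wall_equations {W : MvPolynomial (Fin N) ℂ} {U : Set (Fin N → ℂ)} {n : ℕ}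
    (hU : IsOpen U) (hUR : U ⊆ regularSet W)
    (hs : HasSmoothSections (polyMap (negGradient W)) n U) :
    ∃ (q : ℕ) (f : Fin q → (Fin N → ℂ) → ℝ),
      (∀ j, ContDiffOn ℝ ∞ (f j) U ∧ ∀ b ∈ U, fderiv ℝ (f j) b ≠ 0) ∧
      wall W ∩ U = ⋃ j, {b | b ∈ U ∧ f j b = 0} := by
  obtain ⟨κ, hκ, hfib⟩ := hs
  have hκb : ∀ i, ∀ b ∈ U, polyMap (negGradient W) (κ i b) = b := fun i b hb =>
    ((hfib b hb).2 _).2 ⟨i, rfl⟩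
  let F : {ij : Fin n × Fin n // ij.1 ≠ ij.2} → (Fin N → ℂ) → ℝ := fun ij b =>
    (eval (κ ij.1.1 b) (perturbed W b) - eval (κ ij.1.2 b) (perturbed W b)).im
  let ε := (Fintype.equivFin {ij : Fin n × Fin n // ij.1 ≠ ij.2}).symm
  have hval : ∀ i, ContDiffOn ℂ ∞ (fun b => eval (κ i b) (perturbed W b)) U := fun i => by
    simp only [eval_perturbed]
    have h := contDiffOn_pi.1 (hκ i)
    exact ((contDiff_eval W).comp_contDiffOn (hκ i)).add
      (ContDiffOn.sum fun l _ => (contDiff_apply ℂ ℂ l).contDiffOn.mul (h l))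
  refine ⟨_, fun j => F (ε j), fun j => ⟨?_, fun b hb h0 => ?_⟩, ?_⟩
  · exact Complex.imCLM.contDiff.comp_contDiffOn
      (((hval _).sub (hval _)).restrict_scalars ℝ)
  · change fderiv ℝ (F (ε j)) b = 0 at h0
    generalize ε j = ij at h0
    obtain ⟨⟨i₁, i₂⟩, hi⟩ := ij
    have hd : ∀ i, DifferentiableAt ℂ (κ i) b := fun i =>
      ((hκ i).contDiffAt (hU.mem_nhds hb)).differentiableAt (by simp)
    have h1 := (hasFDerivAt_criticalValue (hd i₁) (hκb i₁ b hb)).sub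
      (hasFDerivAt_criticalValue (hd i₂) (hκb i₂ b hb))
    have h2 := Complex.imCLM.hasFDerivAt.comp b (h1.restrictScalars ℝ)
    have h3 := h2.fderiv.symm.trans h0
    obtain ⟨l, hl⟩ : ∃ l, κ i₁ b l ≠ κ i₂ b l := by
      by_contra! h
      exact hi ((hfib b hb).1 (funext h))
    have hl' := sub_ne_zero.2 hl
    -- in this direction the differential takes the value `Im I = 1`
    have h4 := DFunLike.congr_fun h3 (Pi.single l (Complex.I / (κ i₁ b l - κ i₂ b l)))
    have h5 : κ i₁ b l * (Complex.I / (κ i₁ b l - κ i₂ b l)) -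
        κ i₂ b l * (Complex.I / (κ i₁ b l - κ i₂ b l)) = Complex.I := by
      field_simp
    simp only [ContinuousLinearMap.comp_apply, ContinuousLinearMap.coe_restrictScalars',
      _root_.sub_apply, _root_.sum_apply, _root_.smul_apply,
      ContinuousLinearMap.proj_apply, smul_eq_mul, Pi.single_apply, mul_ite, mul_zero,
      Finset.sum_ite_eq', Finset.mem_univ, if_true, h5] at h4
    simp at h4
  · ext b
    simp only [Set.mem_inter_iff, Set.mem_iUnion, Set.mem_ofPred_eq]
    constructor
    · rintro ⟨⟨-, x, y, hxy, hx, hy, him⟩, hb⟩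
      rw [isCriticalPoint_perturbed_iff] at hx hy
      obtain ⟨i₁, rfl⟩ := ((hfib b hb).2 x).1 hx
      obtain ⟨i₂, rfl⟩ := ((hfib b hb).2 y).1 hy
      refine ⟨ε.symm ⟨(i₁, i₂), fun h => hxy (congrArg (κ · b) h)⟩, hb, ?_⟩
      rw [ε.apply_symm_apply]
      simpa [F, sub_eq_zero] using him
    · rintro ⟨j, hb, hj⟩
      refine ⟨⟨hUR hb, κ (ε j).1.1 b, κ (ε j).1.2 b, fun h => (ε j).2 ((hfib b hb).1 h),
        ?_, ?_, ?_⟩, hb⟩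
      · exact isCriticalPoint_perturbed_iff.2 (hκb _ b hb)
      · exact isCriticalPoint_perturbed_iff.2 (hκb _ b hb)
      · simpa [F, sub_eq_zero] using hj

end Wall

/-! ### Chambers -/

section Chambers

variable {E : Type*} [NormedAddCommGroup E] [NormedSpace ℝ E]

/-- Finitely many functions with nonzero differentials at `p` do not vanish on a short open segment
that starts at `p` in a direction off the kernels of the differentials. -/
theorem exists_segment_forall_ne_zero {q : ℕ} {f : Fin q → E → ℝ} {p : E}
    (hf : ∀ j, DifferentiableAt ℝ (f j) p) (hf' : ∀ j, fderiv ℝ (f j) p ≠ 0) :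
    ∃ v : E, ∀ᶠ t in 𝓝[>] (0 : ℝ), ∀ j, f j (p + t • v) ≠ 0 := by
  obtain ⟨v, hv⟩ : ∃ v, ∀ j, fderiv ℝ (f j) p v ≠ 0 := by
    by_contra! h
    obtain ⟨j, hj⟩ := Subspace.exists_eq_top_of_iUnion_eq_univ
      (p := fun j => LinearMap.ker (fderiv ℝ (f j) p : E →ₗ[ℝ] ℝ))
      (Set.eq_univ_of_forall fun v => Set.mem_iUnion.2 (h v))
    refine hf' j (ContinuousLinearMap.ext fun v => ?_)
    have : v ∈ LinearMap.ker (fderiv ℝ (f j) p : E →ₗ[ℝ] ℝ) := hj ▸ Submodule.mem_top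
    exact this
  refine ⟨v, Filter.eventually_all.2 fun j => ?_⟩
  have hline : HasDerivAt (fun t : ℝ => p + t • v) v 0 := by
    simpa using ((hasDerivAt_id (0 : ℝ)).smul_const v).const_add p
  have hfj : HasFDerivAt (f j) (fderiv ℝ (f j) p) (p + (0 : ℝ) • v) := by
    simpa using (hf j).hasFDerivAt
  have h := (hfj.comp_hasDerivAt 0 hline).eventually_ne (c := 0) (hv j)
  exact h.filter_mono (nhdsWithin_mono _ fun t ht => ne_of_gt ht)

/-- If `H` is locally given in `R` by finitely many equations with nonvanishing differentials, then
every point of `R` is in the closure of a connected component of `R \ H`. -/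
theorem mem_closure_connectedComponentIn {R H U : Set E} {q : ℕ} {f : Fin q → E → ℝ} {p : E}
    (hU : IsOpen U) (hUR : U ⊆ R) (hp : p ∈ U)
    (hf : ∀ j, DifferentiableAt ℝ (f j) p) (hf' : ∀ j, fderiv ℝ (f j) p ≠ 0)
    (hH : H ∩ U = ⋃ j, {b | b ∈ U ∧ f j b = 0}) :
    ∃ b ∈ R \ H, p ∈ closure (connectedComponentIn (R \ H) b) := by
  obtain ⟨v, hv⟩ := exists_segment_forall_ne_zero hf hf'
  have hcont : Continuous fun t : ℝ => p + t • v := by fun_prop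
  have hUt : ∀ᶠ t in 𝓝[>] (0 : ℝ), p + t • v ∈ U :=
    (hcont.continuousAt.eventually (hU.mem_nhds (by simpa using hp))).filter_mono
      nhdsWithin_le_nhds
  obtain ⟨ε, hε, hsub⟩ := mem_nhdsGT_iff_exists_Ioo_subset.1 (hv.and hUt)
  have hε : 0 < ε := hε
  have hmem : (fun t : ℝ => p + t • v) '' Set.Ioo 0 ε ⊆ R \ H := by
    rintro _ ⟨t, ht, rfl⟩
    obtain ⟨h1, h2⟩ := hsub ht
    refine ⟨hUR h2, fun h3 => ?_⟩
    have h4 : p + t • v ∈ H ∩ U := ⟨h3, h2⟩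
    rw [hH] at h4
    obtain ⟨j, -, hj⟩ := Set.mem_iUnion.1 h4
    exact h1 j hj
  have hb : p + (ε / 2) • v ∈ (fun t : ℝ => p + t • v) '' Set.Ioo 0 ε :=
    ⟨ε / 2, ⟨by positivity, by linarith⟩, rfl⟩
  refine ⟨_, hmem hb, closure_mono ((isPreconnected_Ioo.image _
    hcont.continuousOn).subset_connectedComponentIn hb hmem) ?_⟩
  refine image_closure_subset_closure_image hcont ⟨0, ?_, by simp⟩
  rw [closure_Ioo hε.ne]
  exact ⟨le_rfl, hε.le⟩

theorem frontier_connectedComponentIn_inter_subset {X : Type*} [TopologicalSpace X]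
    [LocallyConnectedSpace X] {R H : Set X} (ho : IsOpen (R \ H)) (b : X) :
    frontier (connectedComponentIn (R \ H) b) ∩ R ⊆ H := by
  rintro x ⟨hx, hxR⟩
  by_contra hxH
  have hxX : x ∈ R \ H := ⟨hxR, hxH⟩
  obtain ⟨y, hyx, hyb⟩ := mem_closure_iff.1 hx.1 _ (ho.connectedComponentIn (x := x))
    (mem_connectedComponentIn hxX)
  have hmem : x ∈ connectedComponentIn (R \ H) b := by
    rw [connectedComponentIn_eq hyb, ← connectedComponentIn_eq hyx]
    exact mem_connectedComponentIn hxX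
  exact hx.2 ((ho.connectedComponentIn (x := b)).interior_eq.symm ▸ hmem)

end Chambers

end LandauGinzburg

open LandauGinzburg in
theorem mainTheorem10 {N : ℕ} (W : MvPolynomial (Fin N) ℂ)
    (hW : IsQuasiHomogeneous W) (hnd : IsNondegenerate W) :
    ((regularSet W).Nonempty ∧ IsOpen (regularSet W) ∧ IsPathConnected (regularSet W)) ∧
    (∃ (m : ℕ) (U : Fin m → Set (Fin N → ℂ)),
      (∀ k, IsOpen (U k)) ∧ regularSet W = ⋃ k, U k ∧
      ∀ k, ∃ (n : ℕ) (S : Fin n → Set (Fin N → ℂ)),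
        (∀ j, IsSmoothRealHypersurface (S j) ∧ ∃ Z, IsClosed Z ∧ S j = Z ∩ U k) ∧
        wall W ∩ U k = ⋃ j, S j) ∧
    ((∀ C ∈ chambers W, IsOpen C ∧ IsPathConnected C ∧ frontier C ∩ regularSet W ⊆ wall W) ∧
      (chambers W).PairwiseDisjoint id ∧
      (⋃ C ∈ chambers W, C) = regularSet W \ wall W ∧
      regularSet W ⊆ ⋃ C ∈ chambers W, closure C) := by
  have := isIntegral_adjoin_negGradient hW hnd
  obtain ⟨n, m, U, hU, hRU⟩ := exists_finite_cover_hasSmoothSections (G := negGradient W)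
  have hpath := isPathConnected_regularValues (G := negGradient W)
  have hopen := isOpen_regularValues (G := negGradient W)
  rw [← regularSet_eq] at hRU hpath hopen
  have hUR : ∀ k, U k ⊆ regularSet W := fun k => hRU ▸ Set.subset_iUnion U k
  -- `f k j = 0` are the equations of the wall in `U k`
  choose q f hf hwall using fun k => exists_wall_equations (hU k).1 (hUR k) (hU k).2
  have hclosed : ∀ k j, ∃ Z, IsClosed Z ∧ {b | b ∈ U k ∧ f k j b = 0} = Z ∩ U k := by
    intro k j
    obtain ⟨Z, hZ, h⟩ := continuousOn_iff_isClosed.1 (hf k j).1.continuousOn {0} isClosed_singleton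
    exact ⟨Z, hZ, by rw [← h]; ext b; exact and_comm⟩
  have hchamber : IsOpen (regularSet W \ wall W) := by
    choose Z hZ hZeq using hclosed
    refine isOpen_iff_mem_nhds.2 fun b hb => ?_
    obtain ⟨k, hk⟩ := Set.mem_iUnion.1 (hRU ▸ hb.1)
    have hnhds : U k ∩ ⋂ j, (Z k j)ᶜ ∈ nhds b := by
      refine ((hU k).1.inter (isOpen_iInter_of_finite fun j => (hZ k j).isOpen_compl)).mem_nhds
        ⟨hk, Set.mem_iInter.2 fun j hj => hb.2 ?_⟩
      have : b ∈ wall W ∩ U k := by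
        rw [hwall]
        exact Set.mem_iUnion.2 ⟨j, by rw [hZeq]; exact ⟨hj, hk⟩⟩
      exact this.1
    refine Filter.mem_of_superset hnhds fun c hc => ⟨hUR k hc.1, fun hcw => ?_⟩
    have hcU : c ∈ wall W ∩ U k := ⟨hcw, hc.1⟩
    rw [hwall] at hcU
    obtain ⟨j, hj⟩ := Set.mem_iUnion.1 hcU
    rw [hZeq] at hj
    exact Set.mem_iInter.1 hc.2 j hj.1
  refine ⟨⟨hpath.nonempty, hopen, hpath⟩, ⟨m, U, fun k => (hU k).1, hRU, fun k =>
    ⟨q k, fun j => {b | b ∈ U k ∧ f k j b = 0}, fun j => ⟨?_, hclosed k j⟩, hwall k⟩⟩,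
    ?_, ?_, ?_, ?_⟩
  · rintro p ⟨hp, -⟩
    refine ⟨U k, (hU k).1, hp, f k j, (hf k j).1, fun x hx _ => (hf k j).2 x hx, ?_⟩
    exact Set.inter_eq_left.2 fun b hb => hb.1
  · rintro _ ⟨b, hb, rfl⟩
    refine ⟨hchamber.connectedComponentIn, ?_,
      frontier_connectedComponentIn_inter_subset hchamber b⟩
    exact hchamber.connectedComponentIn.isConnected_iff_isPathConnected.1
      (isConnected_connectedComponentIn_iff.2 hb)
  · rintro _ ⟨b, -, rfl⟩ _ ⟨c, -, rfl⟩ hne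
    refine Set.disjoint_left.2 fun x hxb hxc => hne ?_
    rw [connectedComponentIn_eq hxb, connectedComponentIn_eq hxc]
  · refine Set.Subset.antisymm (Set.iUnion₂_subset ?_) fun b hb => ?_
    · rintro _ ⟨b, -, rfl⟩
      exact connectedComponentIn_subset _ _
    · exact Set.mem_biUnion (⟨b, hb, rfl⟩ : _ ∈ chambers W) (mem_connectedComponentIn hb)
  · intro p hp
    obtain ⟨k, hk⟩ := Set.mem_iUnion.1 (hRU ▸ hp)
    obtain ⟨b, hb, hpb⟩ := mem_closure_connectedComponentIn (hU k).1 (hUR k) hk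
      (fun j => ((hf k j).1.contDiffAt ((hU k).1.mem_nhds hk)).differentiableAt (by simp))
      (fun j => (hf k j).2 p hk) (hwall k)
    exact Set.mem_biUnion (⟨b, hb, rfl⟩ : _ ∈ chambers W) hpb
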